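/- Let $\Lambda$ be a finite set of edge labels with an arity function $\mathrm{ar}\colon\Lambda\to\mathbb N$. A ($\Lambda$-)hypergraph $G=(V_G,E_G,c_G,l_G)$ consists of finite sets $V_G$ of nodes and $E_G$ of edges, a connection function $c_G\colon E_G\to V_G^*$ and a labelling $l_G\colon E_G\to\Lambda$ with $|c_G(e)|=\mathrm{ar}(l_G(e))$ for all $e\in E_G$; $e$ and $v$ are incident if $v$ occurs in $c_G(e)$. An undirected path of length $n$ in $G$ is a sequence $v_0,e_1,v_1,\dots,e_n,v_n$ of pairwise distinct nodes $v_i$ and pairwise distinct edges $e_i$ such that $v_{i-1}$ and $v_i$ are incident to $e_i$ for $1\le i\le n$. For $k\in\mathbb N$ let $\mathcal G_k$ be the set of hypergraphs in which every undirected path has length at most $k$. Write $G_1\subseteq G_2$ (subgraph ordering) if $G_1$ can be obtained, up to isomorphism, from $G_2$ by a finite (possibly empty) sequence of deletions of edges and of isolated nodes. A partial morphism $\phi\colon G\rightharpoonup G'$ is a pair of partial functions $V_G\rightharpoonup V_{G'}$, $E_G\rightharpoonup E_{G'}$ such that, whenever $\phi(e)$ is defined for an edge $e$, $\phi$ is defined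 on all nodes incident to $e$, $l_{G'}(\phi(e))=l_G(e)$ and $c_{G'}(\phi(e))=\phi(c_G(e))$. A rewriting rule is a partial morphism $r\colon L\rightharpoonup R$. A match of $r$ in $G$ is a total morphism $m\colon L\to G$ that is conflict-free: if $m(x)=m(y)$, then $r(x)$ and $r(y)$ are both defined or both undefined. The rule $r$ rewrites $G$ to $H$ if there are a match $m\colon L\to G$ and partial morphisms $m'\colon R\rightharpoonup H$, $r'\colon G\rightharpoonup H$ forming a pushout of $r$ and $m$ in the category of hypergraphs and partial morphisms (single-pushout approach). A graph transformation system is a finite set $\mathcal R$ of rewriting rules; $G\Rightarrow_{\mathcal R}H$ means that some rule of $\mathcal R$ rewrites $G$ to $H$. Let $S$ be a set of states and $Q\subseteq S$. A transition system $(S,\Rightarrow)$ with a relation $\le$ on $S$ is a $Q$-restricted well-structured transition system (WSTS) if 1. $Q$ is downward closed with respect to $\le$, and membership in $Q$ is decidable (for states given by finite descriptions); 2. $\le$ is a quasi-order on $S$ and a well-quasi-order on $Q$, i.e. for every infinite sequence $x_0,x_1,\dots$ in $Q$ there are $i<j$ with $x_i\le x_j$; 3. for all $s_1\le t_1$ and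 every transition $s_1\Rightarrow s_2$ there is $t_2$ with $t_1\Rightarrow^* t_2$ and $s_2\le t_2$. **Proposition.** For every natural number $k$ and every graph transformation system $\mathcal R$ over $\Lambda$, the transition system of all $\Lambda$-hypergraphs with transitions $\Rightarrow_{\mathcal R}$ is a $\mathcal G_k$-restricted WSTS with respect to the subgraph ordering $\subseteq$. -/

import Mathlib

universe u v

namespace GTS

/-! Well-structured transition systems -/

/-- `IsRestrictedWSTS codes Q step le`: the transition system with state set `S`, transitions `step`
and ordering `le` is a `Q`-restricted well-structured transition system.
Decidability of membership in `Q` refers to a description of the states by finite codes: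
`codes c s` says that the code `c` describes the state `s`. -/
structure IsRestrictedWSTS {S : Type u} {C : Type v} [Primcodable C] (codes : C → S → Prop)
    (Q : Set S) (step le : S → S → Prop) : Prop where
  /-- every state has a code -/
  exists_code : ∀ s, ∃ c, codes c s
  /-- an algorithm decides membership in `Q`, given any code of a state -/
  decidable_mem : ∃ P : C → Prop, ComputablePred P ∧ ∀ c s, codes c s → (P c ↔ s ∈ Q)
  /-- `Q` is downward closed -/
  downward_closed : ∀ s t, le s t → t ∈ Q → s ∈ Q
  /-- `le` is a quasi-order on all states -/
  refl : ∀ s, le s s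
  trans : ∀ s t r, le s t → le t r → le s r
  /-- `le` is a well-quasi-order on `Q` -/
  wqo : ∀ x : ℕ → S, (∀ i, x i ∈ Q) → ∃ i j, i < j ∧ le (x i) (x j)
  /-- compatibility -/
  compat : ∀ s₁ s₂ t₁, le s₁ t₁ → step s₁ s₂ →
    ∃ t₂, Relation.ReflTransGen step t₁ t₂ ∧ le s₂ t₂

/-! Hypergraphs -/

/-- Finite hypergraphs whose edges carry labels in `Λ`, the arity of an edge being prescribed
by its label. -/
structure Hypergraph (Λ : Type u) (arity : Λ → ℕ) where
  /-- nodes -/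
  V : Type v
  /-- edges -/
  E : Type v
  finite_V : Finite V
  finite_E : Finite E
  /-- the sequence of nodes connected by an edge -/
  conn : E → List V
  /-- edge labels -/
  lab : E → Λ
  length_conn : ∀ e, (conn e).length = arity (lab e)

namespace Hypergraph

/-- Isomorphism of hypergraphs (a bijective total morphism). -/
def Isomorphic {Λ : Type u} {arity : Λ → ℕ} (G H : Hypergraph.{u, v} Λ arity) : Prop :=
  ∃ (f : G.V ≃ H.V) (g : G.E ≃ H.E),
    ∀ e, H.lab (g e) = G.lab e ∧ H.conn (g e) = (G.conn e).map f

/-- The hypergraph `G` without the edge `e`. -/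
def deleteEdge {Λ : Type u} {arity : Λ → ℕ} (G : Hypergraph.{u, v} Λ arity) (e : G.E) :
    Hypergraph.{u, v} Λ arity where
  V := G.V
  E := {x : G.E // x ≠ e}
  finite_V := G.finite_V
  finite_E := haveI := G.finite_E; inferInstance
  conn x := G.conn x.1
  lab x := G.lab x.1
  length_conn x := G.length_conn x.1

/-- The node `x` is isolated: no edge is incident to it. -/
def IsIsolated {Λ : Type u} {arity : Λ → ℕ} (G : Hypergraph.{u, v} Λ arity) (x : G.V) : Prop :=
  ∀ e, x ∉ G.conn e

/-- The hypergraph `G` without the isolated node `x`. -/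
def deleteNode {Λ : Type u} {arity : Λ → ℕ} (G : Hypergraph.{u, v} Λ arity) (x : G.V)
    (hx : G.IsIsolated x) : Hypergraph.{u, v} Λ arity where
  V := {y : G.V // y ≠ x}
  E := G.E
  finite_V := haveI := G.finite_V; inferInstance
  finite_E := G.finite_E
  conn e := (G.conn e).attachWith (fun y => y ≠ x) (fun _ hy h => hx e (h ▸ hy))
  lab := G.lab
  length_conn e := by rw [List.length_attachWith]; exact G.length_conn e

/-- `IsSubgraph G H`: up to isomorphism, `G` is obtained from `H` by a (possibly empty) sequence
of deletions of edges and isolated nodes. -/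
inductive IsSubgraph {Λ : Type u} {arity : Λ → ℕ} :
    Hypergraph.{u, v} Λ arity → Hypergraph.{u, v} Λ arity → Prop
  | of_iso (G H : Hypergraph.{u, v} Λ arity) : Isomorphic G H → IsSubgraph G H
  | of_deleteEdge (G H : Hypergraph.{u, v} Λ arity) (e : H.E) :
      IsSubgraph G (H.deleteEdge e) → IsSubgraph G H
  | of_deleteNode (G H : Hypergraph.{u, v} Λ arity) (x : H.V) (hx : H.IsIsolated x) :
      IsSubgraph G (H.deleteNode x hx) → IsSubgraph G H

/-- `G` has an (elementary) undirected path of length `n`: an alternating sequence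
`v₀, e₁, v₁, …, eₙ, vₙ` of pairwise distinct nodes and pairwise distinct edges in which
consecutive elements are incident. -/
def HasPath {Λ : Type u} {arity : Λ → ℕ} (G : Hypergraph.{u, v} Λ arity) (n : ℕ) : Prop :=
  ∃ (x : Fin (n + 1) → G.V) (e : Fin n → G.E), Function.Injective x ∧ Function.Injective e ∧
    ∀ i : Fin n, x i.castSucc ∈ G.conn (e i) ∧ x i.succ ∈ G.conn (e i)

/-- The set of hypergraphs all of whose undirected paths have length at most `k`. -/
def pathBounded {Λ : Type u} (arity : Λ → ℕ) (k : ℕ) : Set (Hypergraph.{u, v} Λ arity) :=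
  {G | ∀ n, G.HasPath n → n ≤ k}

/-- Finite descriptions of hypergraphs by numbers, given a numbering `num` of the labels.
The code `(n, [(l₁, s₁), …, (lₘ, sₘ)])` describes a hypergraph with `n` nodes, numbered from `0`,
and `m` edges, where the `i`-th edge has the label with number `lᵢ` and is connected to the nodes
whose numbers are listed in `sᵢ`. -/
def IsCode {Λ : Type u} {arity : Λ → ℕ} (num : Λ → ℕ) (c : ℕ × List (ℕ × List ℕ))
    (G : Hypergraph.{u, v} Λ arity) : Prop :=
  ∃ (f : G.V ≃ Fin c.1) (g : G.E ≃ Fin c.2.length),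
    ∀ e, c.2.get (g e) = (num (G.lab e), (G.conn e).map (fun x => (f x : ℕ)))

end Hypergraph

/-! Partial morphisms and pushouts -/

/-- Partial hypergraph morphisms; `none` stands for undefined. The condition `map_conn` also says
that a morphism that is defined on an edge is defined on all nodes incident to it. -/
@[ext]
structure PMor {Λ : Type u} {arity : Λ → ℕ} (G H : Hypergraph.{u, v} Λ arity) where
  onV : G.V → Option H.V
  onE : G.E → Option H.E
  map_lab : ∀ e e', onE e = some e' → H.lab e' = G.lab e
  map_conn : ∀ e e', onE e = some e' → (G.conn e).map onV = (H.conn e').map some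

namespace PMor

/-- Composition of partial morphisms (first `f`, then `g`). -/
def comp {Λ : Type u} {arity : Λ → ℕ} {G H K : Hypergraph.{u, v} Λ arity}
    (g : PMor H K) (f : PMor G H) : PMor G K where
  onV x := (f.onV x).bind g.onV
  onE e := (f.onE e).bind g.onE
  map_lab e e'' h := by
    obtain ⟨e', h₁, h₂⟩ := Option.bind_eq_some_iff.1 h
    rw [g.map_lab e' e'' h₂, f.map_lab e e' h₁]
  map_conn e e'' h := by
    obtain ⟨e', h₁, h₂⟩ := Option.bind_eq_some_iff.1 h
    have hf := congrArg (List.map (fun o : Option H.V => o.bind g.onV)) (f.map_conn e e' h₁)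
    rw [List.map_map, List.map_map] at hf
    rw [← g.map_conn e' e'' h₂]
    exact hf

/-- A morphism is total if it is defined on all nodes and edges. -/
def IsTotal {Λ : Type u} {arity : Λ → ℕ} {G H : Hypergraph.{u, v} Λ arity} (f : PMor G H) : Prop :=
  (∀ x, (f.onV x).isSome) ∧ ∀ e, (f.onE e).isSome

/-- `m` is conflict-free with respect to `r`: if `m` identifies two elements, then `r` is defined
on both of them or on neither. -/
def IsConflictFree {Λ : Type u} {arity : Λ → ℕ} {L R G : Hypergraph.{u, v} Λ arity}
    (m : PMor L G) (r : PMor L R) : Prop :=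
  (∀ x y, m.onV x = m.onV y → ((r.onV x).isSome ↔ (r.onV y).isSome)) ∧
  ∀ d e, m.onE d = m.onE e → ((r.onE d).isSome ↔ (r.onE e).isSome)

/-- The square formed by `φ : G₀ ⇀ G₁`, `ψ : G₀ ⇀ G₂`, `ψ' : G₁ ⇀ G₃`, `φ' : G₂ ⇀ G₃` is a pushout
in the category of hypergraphs and partial morphisms. -/
def IsPushout {Λ : Type u} {arity : Λ → ℕ} {G₀ G₁ G₂ G₃ : Hypergraph.{u, v} Λ arity}
    (φ : PMor G₀ G₁) (ψ : PMor G₀ G₂) (ψ' : PMor G₁ G₃) (φ' : PMor G₂ G₃) : Prop :=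
  ψ'.comp φ = φ'.comp ψ ∧
  ∀ (K : Hypergraph.{u, v} Λ arity) (a : PMor G₁ K) (b : PMor G₂ K), a.comp φ = b.comp ψ →
    ∃! η : PMor G₃ K, η.comp ψ' = a ∧ η.comp φ' = b

end PMor

/-! Graph transformation systems -/

/-- A rewriting rule is a partial morphism from a left-hand side to a right-hand side. -/
structure Rule (Λ : Type u) (arity : Λ → ℕ) where
  left : Hypergraph.{u, v} Λ arity
  right : Hypergraph.{u, v} Λ arity
  mor : PMor left right

/-- `G` is rewritten to `H` by a rule (single-pushout approach, conflict-free total match). -/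
def Rule.Rewrites {Λ : Type u} {arity : Λ → ℕ} (r : Rule.{u, v} Λ arity)
    (G H : Hypergraph.{u, v} Λ arity) : Prop :=
  ∃ (m : PMor r.left G) (m' : PMor r.right H) (r' : PMor G H),
    m.IsTotal ∧ m.IsConflictFree r.mor ∧ PMor.IsPushout r.mor m m' r'

/-- The transition relation, on all hypergraphs, generated by a set of rules. -/
def Step {Λ : Type u} {arity : Λ → ℕ} (𝓡 : Set (Rule.{u, v} Λ arity))
    (G H : Hypergraph.{u, v} Λ arity) : Prop :=
  ∃ r ∈ 𝓡, r.Rewrites G H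

end GTS

/-!
The subgraph ordering is the existence of embeddings, that is, of injective total morphisms
(`isSubgraph_iff_embeds`), which makes reflexivity, transitivity and downward closure immediate.

*Compatibility.* Let `G` be rewritten to `H` and embedded into `K`. The derived partial morphism
`φ : G ⇀ H` has an explicit pushout along the embedding of `G` into `K`: to `H` one adds the nodes
and edges of `K` outside the image of `G`, except for the edges attached to a node that `φ`
deletes (`PMor.isPushout_pushoutGraph`). In this pushout `H` is embedded. Pasting the two pushout
squares shows that the same rule rewrites `K` to it, at the match composed with the embedding,
which is conflict-free because the embedding is injective.

*Well-quasi-order.* A hypergraph is turned into its incidence structure: a finite set of nodes and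
edges with finitely many labels, where a node and an edge are related by the set of positions at
which the node occurs in the edge. Induced embeddings of incidence structures are embeddings of
hypergraphs, and a bound on the paths of a hypergraph bounds the paths of its incidence structure.
For such structures, consider a connected one with a root from which all paths have at most
`N + 1` elements. Without the root it falls into components, each of which contains a neighbour of
the root, from which all paths have at most `N` elements. If labels record the relation to the
removed root, embeddings of the remaining parts extend to the roots. So, by induction on `N` for
all finite sets of labels at once (`Piece.pwo_rooted`), the components are well-quasi-ordered, and
by Higman's lemma so are lists of components (`Piece.pwo_multiRooted`).

*Decidability.* A path can be truncated, so all paths have length at most `k` if and only if there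
is no path of length `k + 1`. For a coded hypergraph, such a path is a pair of lists of fixed
lengths with bounded entries, so its existence is primitive recursive.
-/

namespace GTS

/-! ### The subgraph ordering as existence of embeddings -/

namespace Hypergraph

variable {Λ : Type u} {arity : Λ → ℕ}

/-- Injective total morphisms, given by their actions `f` on nodes and `g` on edges. -/
structure IsEmbedding (G H : Hypergraph.{u, v} Λ arity) (f : G.V → H.V) (g : G.E → H.E) :
    Prop where
  injV : Function.Injective f
  injE : Function.Injective g
  lab_eq : ∀ e, H.lab (g e) = G.lab e
  conn_eq : ∀ e, H.conn (g e) = (G.conn e).map f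

/-- `G` embeds into `H`: there is an injective total morphism from `G` to `H`. -/
def Embeds (G H : Hypergraph.{u, v} Λ arity) : Prop :=
  ∃ f g, IsEmbedding G H f g

theorem Embeds.refl (G : Hypergraph.{u, v} Λ arity) : Embeds G G :=
  ⟨id, id, Function.injective_id, Function.injective_id, fun _ => rfl, fun _ => by simp⟩

theorem Embeds.trans {G H K : Hypergraph.{u, v} Λ arity} :
    Embeds G H → Embeds H K → Embeds G K := by
  rintro ⟨f, g, h⟩ ⟨f', g', h'⟩
  exact ⟨f' ∘ f, g' ∘ g, h'.injV.comp h.injV, h'.injE.comp h.injE,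
    fun e => by simp [h'.lab_eq, h.lab_eq], fun e => by simp [h'.conn_eq, h.conn_eq]⟩

theorem Isomorphic.embeds {G H : Hypergraph.{u, v} Λ arity} : Isomorphic G H → Embeds G H := by
  rintro ⟨f, g, h⟩
  exact ⟨f, g, f.injective, g.injective, fun e => (h e).1, fun e => (h e).2⟩

theorem embeds_deleteEdge (H : Hypergraph.{u, v} Λ arity) (e : H.E) :
    Embeds (H.deleteEdge e) H :=
  ⟨id, Subtype.val, Function.injective_id, Subtype.val_injective, fun _ => rfl,
    fun _ => (List.map_id _).symm⟩

theorem embeds_deleteNode (H : Hypergraph.{u, v} Λ arity) (x : H.V) (hx : H.IsIsolated x) :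
    Embeds (H.deleteNode x hx) H :=
  ⟨Subtype.val, id, Subtype.val_injective, Function.injective_id, fun _ => rfl,
    fun _ => (List.attachWith_map_subtype_val _).symm⟩

theorem IsSubgraph.embeds {G H : Hypergraph.{u, v} Λ arity} (h : IsSubgraph G H) :
    Embeds G H := by
  induction h with
  | of_iso _ h => exact h.embeds
  | of_deleteEdge H e _ ih => exact ih.trans (embeds_deleteEdge H e)
  | of_deleteNode H x hx _ ih => exact ih.trans (embeds_deleteNode H x hx)

/-- Elements outside the image of an embedding can be deleted one by one, edges first: once every
edge lies in the image, a node outside the image is isolated. -/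
theorem Embeds.isSubgraph {G H : Hypergraph.{u, v} Λ arity} (h : Embeds G H) :
    IsSubgraph G H := by
  obtain ⟨n, hn⟩ : ∃ n, Nat.card H.V + Nat.card H.E = n := ⟨_, rfl⟩
  induction n using Nat.strong_induction_on generalizing H with
  | _ n ih =>
  obtain ⟨f, g, h⟩ := h
  have := H.finite_V
  have := H.finite_E
  by_cases hg : Function.Surjective g
  · by_cases hf : Function.Surjective f
    · exact .of_iso _ _ ⟨.ofBijective f ⟨h.injV, hf⟩, .ofBijective g ⟨h.injE, hg⟩,
        fun e => ⟨h.lab_eq e, h.conn_eq e⟩⟩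
    · obtain ⟨x, hx⟩ := not_forall.1 hf
      have hx' : ∀ y, f y ≠ x := fun y hy => hx ⟨y, hy⟩
      have hiso : H.IsIsolated x := by
        intro e he
        obtain ⟨d, rfl⟩ := hg e
        rw [h.conn_eq] at he
        obtain ⟨y, -, hy⟩ := List.mem_map.1 he
        exact hx' y hy
      refine .of_deleteNode _ _ x hiso (ih _ ?_ ?_ rfl)
      · rw [← hn]
        exact Nat.add_lt_add_right (Finite.card_subtype_lt (x := x) (fun h => h rfl)) _
      · refine ⟨fun y => ⟨f y, hx' y⟩, g, fun y z hyz => h.injV (congrArg Subtype.val hyz),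
          h.injE, h.lab_eq, fun e => ?_⟩
        apply List.map_injective_iff.2 Subtype.val_injective
        refine (List.attachWith_map_subtype_val _).trans ?_
        exact (h.conn_eq e).trans (List.map_map (g := Subtype.val)
          (f := fun y => (⟨f y, hx' y⟩ : {y : H.V // y ≠ x}))).symm
  · obtain ⟨e, he⟩ := not_forall.1 hg
    have he' : ∀ d, g d ≠ e := fun y hy => he ⟨y, hy⟩
    refine .of_deleteEdge _ _ e (ih _ ?_ ?_ rfl)
    · rw [← hn]
      exact Nat.add_lt_add_left (Finite.card_subtype_lt (x := e) (fun h => h rfl)) _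
    · exact ⟨f, fun d => ⟨g d, he' d⟩, h.injV, fun y z hyz => h.injE (congrArg Subtype.val hyz),
        fun d => h.lab_eq d, fun d => h.conn_eq d⟩

theorem isSubgraph_iff_embeds {G H : Hypergraph.{u, v} Λ arity} :
    IsSubgraph G H ↔ Embeds G H :=
  ⟨IsSubgraph.embeds, Embeds.isSubgraph⟩

theorem HasPath.of_embeds {G H : Hypergraph.{u, v} Λ arity} (h : Embeds G H) {n : ℕ}
    (hp : G.HasPath n) : H.HasPath n := by
  obtain ⟨f, g, h⟩ := h
  obtain ⟨x, e, hx, he, hxe⟩ := hp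
  refine ⟨f ∘ x, g ∘ e, h.injV.comp hx, h.injE.comp he, fun i => ?_⟩
  simp only [Function.comp_apply, h.conn_eq]
  exact ⟨List.mem_map_of_mem (hxe i).1, List.mem_map_of_mem (hxe i).2⟩

theorem HasPath.mono {G : Hypergraph.{u, v} Λ arity} {m n : ℕ} (hmn : m ≤ n)
    (hp : G.HasPath n) : G.HasPath m := by
  obtain ⟨x, e, hx, he, hxe⟩ := hp
  exact ⟨fun i => x (i.castLE (Nat.succ_le_succ hmn)), fun i => e (i.castLE hmn),
    hx.comp (Fin.castLE_injective _), he.comp (Fin.castLE_injective _),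
    fun i => hxe (i.castLE hmn)⟩

/-- A path can be truncated, so the bound on path lengths concerns a single length. -/
theorem mem_pathBounded_iff {G : Hypergraph.{u, v} Λ arity} {k : ℕ} :
    G ∈ pathBounded.{u, v} arity k ↔ ¬ G.HasPath (k + 1) :=
  ⟨fun h hp => absurd (h _ hp) (by omega), fun h n hn => by
    by_contra! hk
    exact h (hn.mono hk)⟩

end Hypergraph

/-! ### Pushouts of partial morphisms along embeddings -/

namespace PMor

variable {Λ : Type u} {arity : Λ → ℕ}

theorem comp_assoc {G H K M : Hypergraph.{u, v} Λ arity} (h : PMor K M) (g : PMor H K)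
    (f : PMor G H) : (h.comp g).comp f = h.comp (g.comp f) := by
  apply PMor.ext
  · funext x
    exact (Option.bind_assoc (f.onV x) g.onV h.onV).symm
  · funext e
    exact (Option.bind_assoc (f.onE e) g.onE h.onE).symm

/-- Pasting of pushout squares. -/
theorem IsPushout.paste {G₀ G₁ G₂ G₃ G₄ G₅ : Hypergraph.{u, v} Λ arity} {φ : PMor G₀ G₁}
    {ψ : PMor G₀ G₂} {ψ' : PMor G₁ G₃} {φ' : PMor G₂ G₃} {χ : PMor G₂ G₄} {χ' : PMor G₃ G₅}
    {φ'' : PMor G₄ G₅} (h₁ : IsPushout φ ψ ψ' φ') (h₂ : IsPushout φ' χ χ' φ'') :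
    IsPushout φ (χ.comp ψ) (χ'.comp ψ') φ'' := by
  refine ⟨?_, fun K a b hab => ?_⟩
  · rw [comp_assoc, h₁.1, ← comp_assoc, h₂.1, comp_assoc]
  · rw [← comp_assoc] at hab
    obtain ⟨c, ⟨hc₁, hc₂⟩, hcu⟩ := h₁.2 K a (b.comp χ) hab
    obtain ⟨d, ⟨hd₁, hd₂⟩, hdu⟩ := h₂.2 K c b hc₂
    refine ⟨d, ⟨by rw [← comp_assoc, hd₁, hc₁], hd₂⟩, ?_⟩
    rintro d' ⟨h, h'⟩
    refine hdu d' ⟨hcu _ ⟨by rw [comp_assoc, h], ?_⟩, h'⟩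
    rw [comp_assoc, h₂.1, ← comp_assoc, h']

/-- The total partial morphism given by an embedding. -/
def ofEmbedding {G H : Hypergraph.{u, v} Λ arity} {f : G.V → H.V} {g : G.E → H.E}
    (h : Hypergraph.IsEmbedding G H f g) : PMor G H where
  onV x := some (f x)
  onE e := some (g e)
  map_lab e e' he := by
    rw [← Option.some_inj.1 he, h.lab_eq]
  map_conn e e' he := by
    rw [← Option.some_inj.1 he, h.conn_eq, List.map_map]
    rfl

section PushoutAlongEmbedding

variable {G H K : Hypergraph.{u, v} Λ arity} {f : G.V → K.V} {g : G.E → K.E}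

open Classical in
/-- The node of the pushout to which a node of `K` is mapped, if any: a node of `G` goes where `φ`
sends it, any other node is kept. -/
noncomputable def pushoutV (f : G.V → K.V) (φ : PMor G H) (y : K.V) :
    Option (H.V ⊕ {y : K.V // y ∉ Set.range f}) :=
  if h : y ∈ Set.range f then (φ.onV h.choose).map Sum.inl else some (Sum.inr ⟨y, h⟩)

theorem pushoutV_apply (hf : Function.Injective f) (φ : PMor G H) (x : G.V) :
    pushoutV f φ (f x) = (φ.onV x).map Sum.inl := by
  have h : f x ∈ Set.range f := ⟨x, rfl⟩
  rw [pushoutV, dif_pos h, hf h.choose_spec]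

theorem pushoutV_of_notMem (φ : PMor G H) (y : K.V) (h : y ∉ Set.range f) :
    pushoutV f φ y = some (Sum.inr ⟨y, h⟩) := by
  rw [pushoutV, dif_neg h]

/-- The edges of `K` outside the image of `G` that survive in the pushout: those none of whose
nodes is deleted. -/
def SurvivingEdge (f : G.V → K.V) (g : G.E → K.E) (φ : PMor G H) : Type v :=
  {e : K.E // e ∉ Set.range g ∧ ∀ y ∈ K.conn e, (pushoutV f φ y).isSome}

/-- The pushout of a partial morphism `φ : G ⇀ H` along an embedding of `G` into `K`: the
hypergraph `H` together with the part of `K` outside the image of `G`, without the edges attached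
to a node that `φ` deletes. -/
noncomputable def pushoutGraph (f : G.V → K.V) (g : G.E → K.E) (φ : PMor G H) :
    Hypergraph.{u, v} Λ arity where
  V := H.V ⊕ {y : K.V // y ∉ Set.range f}
  E := H.E ⊕ SurvivingEdge f g φ
  finite_V := haveI := H.finite_V; haveI := K.finite_V; inferInstance
  finite_E :=
    haveI := H.finite_E
    haveI := K.finite_E
    haveI : Finite (SurvivingEdge f g φ) := Subtype.finite
    inferInstance
  conn := Sum.elim (fun e => (H.conn e).map Sum.inl)
    (fun e => (K.conn e.1).attach.map fun y => (pushoutV f φ y.1).get (e.2.2 y.1 y.2))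
  lab := Sum.elim H.lab (fun e => K.lab e.1)
  length_conn := by
    rintro (e | e)
    · simpa using H.length_conn e
    · simpa using K.length_conn e.1

theorem isEmbedding_inl (f : G.V → K.V) (g : G.E → K.E) (φ : PMor G H) :
    Hypergraph.IsEmbedding H (pushoutGraph f g φ) Sum.inl Sum.inl :=
  ⟨Sum.inl_injective, Sum.inl_injective, fun _ => rfl, fun _ => rfl⟩

theorem map_some_conn_inr (φ : PMor G H) (e : SurvivingEdge f g φ) :
    ((pushoutGraph f g φ).conn (Sum.inr e)).map some = (K.conn e.1).map (pushoutV f φ) := by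
  simp [pushoutGraph, List.map_attach_eq_pmap, List.map_pmap, List.pmap_eq_map]

open Classical in
/-- The action on edges of the canonical morphism from `K` to the pushout. -/
noncomputable def pushoutE (f : G.V → K.V) (g : G.E → K.E) (φ : PMor G H) (e : K.E) :
    Option (H.E ⊕ SurvivingEdge f g φ) :=
  if h : e ∈ Set.range g then (φ.onE h.choose).map Sum.inl else
    if h' : ∀ y ∈ K.conn e, (pushoutV f φ y).isSome then some (Sum.inr ⟨e, h, h'⟩) else none

theorem pushoutE_apply (hg : Function.Injective g) (φ : PMor G H) (e : G.E) :
    pushoutE f g φ (g e) = (φ.onE e).map Sum.inl := by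
  have h : g e ∈ Set.range g := ⟨e, rfl⟩
  rw [pushoutE, dif_pos h, hg h.choose_spec]

theorem pushoutE_surviving (φ : PMor G H) (e : SurvivingEdge f g φ) :
    pushoutE f g φ e.1 = some (Sum.inr e) := by
  rw [pushoutE, dif_neg e.2.1, dif_pos e.2.2]
  rfl

theorem pushoutE_eq_some_inr {φ : PMor G H} {e : K.E} {d : SurvivingEdge f g φ}
    (h : pushoutE f g φ e = some (Sum.inr d)) : d.1 = e := by
  unfold pushoutE at h
  split_ifs at h with h₁ h₂
  · simp at h
  · rw [← Sum.inr_injective (Option.some_inj.1 h)]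

/-- The canonical morphism from `K` to the pushout. -/
noncomputable def pushoutMor (he : Hypergraph.IsEmbedding G K f g) (φ : PMor G H) :
    PMor K (pushoutGraph f g φ) where
  onV := pushoutV f φ
  onE := pushoutE f g φ
  map_lab e e' h := by
    by_cases hr : e ∈ Set.range g
    · obtain ⟨d, rfl⟩ := hr
      rw [pushoutE_apply he.injE] at h
      obtain ⟨d', hd, rfl⟩ := Option.map_eq_some_iff.1 h
      rw [he.lab_eq, ← φ.map_lab d d' hd]
      rfl
    · rcases e' with d | d
      · unfold pushoutE at h
        split_ifs at h
        exact absurd (Option.some_inj.1 h) Sum.inr_ne_inl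
      · rw [← pushoutE_eq_some_inr h]
        rfl
  map_conn e e' h := by
    by_cases hr : e ∈ Set.range g
    · obtain ⟨d, rfl⟩ := hr
      rw [pushoutE_apply he.injE] at h
      obtain ⟨d', hd, rfl⟩ := Option.map_eq_some_iff.1 h
      rw [he.conn_eq]
      have := congrArg (List.map (Option.map (Sum.inl (β := {y : K.V // y ∉ Set.range f}))))
        (φ.map_conn d d' hd)
      rw [List.map_map, List.map_map] at this
      refine List.map_map.trans (Eq.trans (List.map_congr_left fun x _ => ?_) (this.trans ?_))
      · exact pushoutV_apply he.injV φ x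
      · exact (List.map_map (f := Sum.inl) (g := some) (l := H.conn d')).symm
    · rcases e' with d | d
      · unfold pushoutE at h
        split_ifs at h
        exact absurd (Option.some_inj.1 h) Sum.inr_ne_inl
      · rw [← pushoutE_eq_some_inr h]
        exact (map_some_conn_inr φ d).symm

theorem pushoutV_bind_elim (he : Hypergraph.IsEmbedding G K f g) (φ : PMor G H)
    {M : Hypergraph.{u, v} Λ arity} (a : PMor H M) (b : PMor K M)
    (hab : a.comp φ = b.comp (ofEmbedding he)) (y : K.V) :
    (pushoutV f φ y).bind (Sum.elim a.onV fun y => b.onV y.1) = b.onV y := by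
  by_cases hy : y ∈ Set.range f
  · obtain ⟨x, rfl⟩ := hy
    have hx : (φ.onV x).bind a.onV = b.onV (f x) := congrFun (congrArg PMor.onV hab) x
    rw [← hx, pushoutV_apply he.injV, Option.bind_map]
    rfl
  · rw [pushoutV_of_notMem φ y hy]
    rfl

/-- The morphism out of the pushout that is determined by `a` on `H` and `b` on `K`. -/
noncomputable def pushoutDesc (he : Hypergraph.IsEmbedding G K f g) (φ : PMor G H)
    {M : Hypergraph.{u, v} Λ arity} (a : PMor H M) (b : PMor K M)
    (hab : a.comp φ = b.comp (ofEmbedding he)) : PMor (pushoutGraph f g φ) M where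
  onV := Sum.elim a.onV fun y => b.onV y.1
  onE := Sum.elim a.onE fun e => b.onE e.1
  map_lab := by
    rintro (e | e) e' h
    · exact a.map_lab e e' h
    · exact b.map_lab e.1 e' h
  map_conn := by
    rintro (e | e) e' h
    · rw [← a.map_conn e e' h]
      exact List.map_map
    · rw [← b.map_conn e.1 e' h]
      have key := congrArg (List.map fun o : Option (pushoutGraph f g φ).V =>
        o.bind (Sum.elim a.onV fun y => b.onV y.1)) (map_some_conn_inr φ e)
      refine (List.map_map (f := some) (l := (pushoutGraph f g φ).conn (Sum.inr e))).symm.trans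
        ((key.trans List.map_map).trans (List.map_congr_left fun y _ => ?_))
      exact pushoutV_bind_elim he φ a b hab y

theorem isPushout_pushoutGraph (he : Hypergraph.IsEmbedding G K f g) (φ : PMor G H) :
    IsPushout φ (ofEmbedding he) (ofEmbedding (isEmbedding_inl f g φ)) (pushoutMor he φ) := by
  refine ⟨?_, fun M a b hab => ⟨pushoutDesc he φ a b hab, ⟨?_, ?_⟩, ?_⟩⟩
  · apply PMor.ext
    · funext x
      exact (Option.map_eq_bind (f := Sum.inl)).symm.trans (pushoutV_apply he.injV φ x).symm
    · funext e
      exact (Option.map_eq_bind (f := Sum.inl)).symm.trans (pushoutE_apply he.injE φ e).symm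
  · rfl
  · apply PMor.ext
    · funext y
      exact pushoutV_bind_elim he φ a b hab y
    · funext e
      by_cases hr : e ∈ Set.range g
      · obtain ⟨d, rfl⟩ := hr
        have hx : (φ.onE d).bind a.onE = b.onE (g d) := congrFun (congrArg PMor.onE hab) d
        change (pushoutE f g φ (g d)).bind _ = _
        rw [← hx, pushoutE_apply he.injE]
        exact Option.bind_map
      · change (pushoutE f g φ e).bind _ = _
        by_cases hs : ∀ y ∈ K.conn e, (pushoutV f φ y).isSome
        · exact congrArg (fun o => o.bind (pushoutDesc he φ a b hab).onE)
            (pushoutE_surviving φ ⟨e, hr, hs⟩)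
        · rw [pushoutE, dif_neg hr, dif_neg hs]
          -- If `b` were defined on `e`, then `a` would be defined on the images under `φ` of the
          -- nodes of `e` that come from `G`; hence `φ` would delete no node of `e`.
          symm
          by_contra hb
          obtain ⟨e', he'⟩ := Option.ne_none_iff_exists'.1 hb
          apply hs
          intro y hy
          by_cases hy' : y ∈ Set.range f
          · obtain ⟨x, rfl⟩ := hy'
            have hx : (φ.onV x).bind a.onV = b.onV (f x) := congrFun (congrArg PMor.onV hab) x
            have hm : b.onV (f x) ∈ (K.conn e).map b.onV := List.mem_map_of_mem hy
            rw [b.map_conn e e' he', ← hx] at hm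
            obtain ⟨z, -, hz⟩ := List.mem_map.1 hm
            rw [pushoutV_apply he.injV]
            cases h : φ.onV x with
            | none => simp [h] at hz
            | some w => rfl
          · rw [pushoutV_of_notMem φ y hy']
            rfl
  · rintro η ⟨h₁, h₂⟩
    apply PMor.ext
    · funext x
      rcases x with x | ⟨y, hy⟩
      · exact congrFun (congrArg PMor.onV h₁) x
      · have : (pushoutV f φ y).bind η.onV = b.onV y := congrFun (congrArg PMor.onV h₂) y
        rw [pushoutV_of_notMem φ y hy] at this
        exact this
    · funext x
      rcases x with e | e
      · exact congrFun (congrArg PMor.onE h₁) e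
      · have : (pushoutE f g φ e.1).bind η.onE = b.onE e.1 := congrFun (congrArg PMor.onE h₂) e.1
        rw [pushoutE_surviving] at this
        exact this

end PushoutAlongEmbedding

end PMor

/-! ### Compatibility -/

/-- A rule application carries over to a larger hypergraph: the match is composed with the
embedding, and the pushout of the step along the embedding is pasted to the step. -/
theorem Rule.Rewrites.of_embeds {Λ : Type u} {arity : Λ → ℕ} {r : Rule.{u, v} Λ arity}
    {G H K : Hypergraph.{u, v} Λ arity} (hGK : Hypergraph.Embeds G K) (h : r.Rewrites G H) :
    ∃ M, r.Rewrites K M ∧ Hypergraph.Embeds H M := by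
  obtain ⟨f, g, he⟩ := hGK
  obtain ⟨m, m', r', hm, hc, hp⟩ := h
  refine ⟨PMor.pushoutGraph f g r', ⟨(PMor.ofEmbedding he).comp m, _, _, ?_, ?_,
    hp.paste (PMor.isPushout_pushoutGraph he r')⟩, _, _, PMor.isEmbedding_inl f g r'⟩
  · refine ⟨fun x => ?_, fun x => ?_⟩
    · obtain ⟨y, hy⟩ := Option.isSome_iff_exists.1 (hm.1 x)
      simp [PMor.comp, PMor.ofEmbedding, hy]
    · obtain ⟨y, hy⟩ := Option.isSome_iff_exists.1 (hm.2 x)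
      simp [PMor.comp, PMor.ofEmbedding, hy]
  · refine ⟨fun x y h => hc.1 x y (Option.map_injective he.injV ?_),
      fun x y h => hc.2 x y (Option.map_injective he.injE ?_)⟩
    · rw [Option.map_eq_bind, Option.map_eq_bind]
      exact h
    · rw [Option.map_eq_bind, Option.map_eq_bind]
      exact h

/-! ### Labelled symmetric structures with bounded paths -/

/-- A part `S` of a finite set `X` whose elements carry labels in `L`, and each pair of whose
elements carries a value in `D`, symmetrically. The value `⊥` means that the two elements are not
adjacent. The carrier `X` stays fixed when `S` is divided into parts, so that no subtypes are
needed. -/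
structure Piece (L : Type u) (D : Type) where
  X : Type v
  finite_X : Finite X
  S : Set X
  lab : X → L
  rel : X → X → D
  symm : ∀ x y, rel x y = rel y x

namespace Piece

variable {L : Type u} {D : Type}

/-- `f` embeds the part `S` of the carrier of `P` into the part `T` of the carrier of `Q`,
preserving labels and values of pairs. -/
structure IsEmbOn (P Q : Piece.{u, v} L D) (f : P.X → Q.X) (S : Set P.X) (T : Set Q.X) :
    Prop where
  injOn : Set.InjOn f S
  mapsTo : Set.MapsTo f S T
  lab_eq : ∀ x ∈ S, Q.lab (f x) = P.lab x
  rel_eq : ∀ x ∈ S, ∀ y ∈ S, Q.rel (f x) (f y) = P.rel x y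

/-- `P` embeds into `Q` as an induced substructure. -/
def Le (P Q : Piece.{u, v} L D) : Prop :=
  ∃ f, IsEmbOn P Q f P.S Q.S

instance : IsPreorder (Piece.{u, v} L D) Le where
  refl _ := ⟨id, Set.injOn_id _, Set.mapsTo_id _, fun _ _ => rfl, fun _ _ _ _ => rfl⟩
  trans := by
    rintro P Q R ⟨f, hf⟩ ⟨g, hg⟩
    refine ⟨g ∘ f, hg.injOn.comp hf.injOn hf.mapsTo, hg.mapsTo.comp hf.mapsTo, fun x hx => ?_,
      fun x hx y hy => ?_⟩
    · exact (hg.lab_eq _ (hf.mapsTo hx)).trans (hf.lab_eq x hx)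
    · exact (hg.rel_eq _ (hf.mapsTo hx) _ (hf.mapsTo hy)).trans (hf.rel_eq x hx y hy)

/-- The part `K` of the carrier of `P`. -/
def restrict (P : Piece.{u, v} L D) (K : Set P.X) : Piece.{u, v} L D :=
  { P with S := K }

/-- The piece without the element `v`; the label of an element now records how it was related
to `v`. -/
def removeRoot (P : Piece.{u, v} L D) (v : P.X) : Piece.{u, v} (L × D) D :=
  { P with
    S := P.S \ {v}
    lab := fun x => (P.lab x, P.rel v x) }

theorem Le.of_removeRoot {P Q : Piece.{u, v} L D} {v : P.X} {w : Q.X} (hw : w ∈ Q.S)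
    (hlab : P.lab v = Q.lab w) (hrel : P.rel v v = Q.rel w w)
    (h : Le (P.removeRoot v) (Q.removeRoot w)) : Le P Q := by
  obtain ⟨f, hf⟩ := h
  classical
  let F : P.X → Q.X := fun x => if x = v then w else f x
  have Fv : F v = w := if_pos rfl
  have Ff : ∀ x, x ≠ v → F x = f x := fun x hx => if_neg hx
  have hfw : ∀ x ∈ P.S, x ≠ v → f x ≠ w := fun x hx hxv => (hf.mapsTo ⟨hx, hxv⟩).2
  have hl : ∀ x ∈ P.S, x ≠ v → (Q.lab (f x), Q.rel w (f x)) = (P.lab x, P.rel v x) :=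
    fun x hx hxv => hf.lab_eq x ⟨hx, hxv⟩
  refine ⟨F, fun x hx y hy hxy => ?_, fun x hx => ?_, fun x hx => ?_, fun x hx y hy => ?_⟩
  · by_cases hxv : x = v <;> by_cases hyv : y = v
    · rw [hxv, hyv]
    · rw [hxv, Fv, Ff y hyv] at hxy
      exact absurd hxy.symm (hfw y hy hyv)
    · rw [hyv, Fv, Ff x hxv] at hxy
      exact absurd hxy (hfw x hx hxv)
    · rw [Ff x hxv, Ff y hyv] at hxy
      exact hf.injOn ⟨hx, hxv⟩ ⟨hy, hyv⟩ hxy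
  · by_cases hxv : x = v
    · rwa [hxv, Fv]
    · rw [Ff x hxv]
      exact (hf.mapsTo ⟨hx, hxv⟩).1
  · by_cases hxv : x = v
    · rw [hxv, Fv, hlab]
    · rw [Ff x hxv]
      exact congrArg Prod.fst (hl x hx hxv)
  · by_cases hxv : x = v <;> by_cases hyv : y = v
    · rw [hxv, hyv, Fv, hrel]
    · rw [hxv, Fv, Ff y hyv]
      exact congrArg Prod.snd (hl y hy hyv)
    · rw [hyv, Fv, Ff x hxv, P.symm]
      exact (Q.symm _ _).trans (congrArg Prod.snd (hl x hx hxv))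
    · rw [Ff x hxv, Ff y hyv]
      exact hf.rel_eq x ⟨hx, hxv⟩ y ⟨hy, hyv⟩

variable [Bot D]

/-- Two elements are adjacent. -/
def Adj (P : Piece.{u, v} L D) (x y : P.X) : Prop :=
  P.rel x y ≠ ⊥

theorem Adj.symm {P : Piece.{u, v} L D} {x y : P.X} (h : P.Adj x y) : P.Adj y x := by
  rwa [Adj, P.symm]

/-- A path inside `P.S`, given by the list of its elements. -/
structure IsPath (P : Piece.{u, v} L D) (l : List P.X) : Prop where
  nodup : l.Nodup
  chain : l.IsChain P.Adj
  mem : ∀ x ∈ l, x ∈ P.S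

/-- `y` can be reached from `x` inside `P.S`. -/
def Reach (P : Piece.{u, v} L D) : P.X → P.X → Prop :=
  Relation.ReflTransGen fun x y => P.Adj x y ∧ y ∈ P.S

/-- Every path starting at `x` has at most `N` elements. -/
def BoundedFrom (P : Piece.{u, v} L D) (N : ℕ) (x : P.X) : Prop :=
  ∀ l, P.IsPath (x :: l) → l.length < N

/-- The connected pieces with an element all paths from which have at most `N` elements. -/
def rooted (L : Type u) (D : Type) [Bot D] (N : ℕ) : Set (Piece.{u, v} L D) :=
  {P | ∃ v ∈ P.S, (∀ x ∈ P.S, P.Reach v x) ∧ P.BoundedFrom N v}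

/-- The pieces whose connected components belong to `rooted L D N`. -/
def multiRooted (L : Type u) (D : Type) [Bot D] (N : ℕ) : Set (Piece.{u, v} L D) :=
  {P | ∀ x ∈ P.S, ∃ v ∈ P.S, P.Reach v x ∧ P.BoundedFrom N v}

theorem Reach.symm {P : Piece.{u, v} L D} {x y : P.X} (hx : x ∈ P.S) (h : P.Reach x y) :
    P.Reach y x := by
  induction h with
  | refl => exact .refl
  | @tail b c hb hbc ih =>
    have hbS : b ∈ P.S := by
      cases hb with
      | refl => exact hx
      | tail _ h => exact h.2
    exact .head ⟨hbc.1.symm, hbS⟩ ih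

/-- The connected component of `x`. -/
def component (P : Piece.{u, v} L D) (x : P.X) : Set P.X :=
  {y | y ∈ P.S ∧ P.Reach x y}

theorem component_eq {P : Piece.{u, v} L D} {x y : P.X} (hx : x ∈ P.S) (h : P.Reach x y) :
    P.component x = P.component y := by
  ext z
  exact ⟨fun hz => ⟨hz.1, (h.symm hx).trans hz.2⟩, fun hz => ⟨hz.1, h.trans hz.2⟩⟩

theorem restrict_component_mem_rooted {P : Piece.{u, v} L D} {N : ℕ} {v : P.X} (hv : v ∈ P.S)
    (hN : P.BoundedFrom N v) : P.restrict (P.component v) ∈ rooted L D N := by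
  refine ⟨v, ⟨hv, .refl⟩, fun x hx => ?_, fun l hl =>
    hN l ⟨hl.nodup, hl.chain, fun y hy => (hl.mem y hy).1⟩⟩
  obtain ⟨-, hx⟩ := hx
  induction hx with
  | refl => exact .refl
  | tail hb hbc ih => exact .tail ih ⟨hbc.1, hbc.2, .tail hb hbc⟩

/-- `K` and `K'` are disjoint and no element of `K` is adjacent to an element of `K'`. -/
def Separated (P : Piece.{u, v} L D) (K K' : Set P.X) : Prop :=
  ∀ x ∈ K, ∀ y ∈ K', x ≠ y ∧ P.rel x y = ⊥

theorem separated_component {P : Piece.{u, v} L D} {x y : P.X} (hx : x ∈ P.S) (hy : y ∈ P.S)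
    (h : P.component x ≠ P.component y) : P.Separated (P.component x) (P.component y) := by
  intro a ha b hb
  refine ⟨?_, ?_⟩
  · rintro rfl
    exact h ((component_eq hx ha.2).trans (component_eq hy hb.2).symm)
  · by_contra hab
    exact h ((component_eq hx (.tail ha.2 ⟨hab, hb.1⟩)).trans (component_eq hy hb.2).symm)

/-- The list, in some order, of the connected components of `P`. -/
noncomputable def components (P : Piece.{u, v} L D) : List (Set P.X) :=
  haveI := P.finite_X
  (Set.toFinite (P.component '' P.S)).toFinset.toList

theorem mem_components {P : Piece.{u, v} L D} {K : Set P.X} :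
    K ∈ P.components ↔ ∃ x ∈ P.S, P.component x = K := by
  simp [components]

theorem pairwise_components (P : Piece.{u, v} L D) : P.components.Pairwise P.Separated := by
  refine List.Nodup.pairwise_of_forall_ne (Finset.nodup_toList _) fun K hK K' hK' hne => ?_
  obtain ⟨x, hx, rfl⟩ := mem_components.1 hK
  obtain ⟨y, hy, rfl⟩ := mem_components.1 hK'
  exact separated_component hx hy hne

theorem exists_mem_components {P : Piece.{u, v} L D} {x : P.X} :
    (∃ K ∈ P.components, x ∈ K) ↔ x ∈ P.S := by
  constructor
  · rintro ⟨K, hK, hx⟩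
    obtain ⟨y, -, rfl⟩ := mem_components.1 hK
    exact hx.1
  · exact fun hx => ⟨_, mem_components.2 ⟨x, hx, rfl⟩, hx, .refl⟩

/-- Embeddings of pairwise separated parts of `P` into different ones among pairwise separated
parts of `Q` combine to an embedding of the union. -/
theorem exists_isEmbOn_of_sublistForall₂ {P Q : Piece.{u, v} L D} {A : List (Set P.X)}
    {B : List (Set Q.X)}
    (h : List.SublistForall₂ (fun K K' => Le (P.restrict K) (Q.restrict K')) A B)
    (hA : A.Pairwise P.Separated) (hB : B.Pairwise Q.Separated)
    (f₀ : P.X → Q.X) : ∃ f, IsEmbOn P Q f {x | ∃ K ∈ A, x ∈ K} {y | ∃ K ∈ B, y ∈ K} := by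
  induction h with
  | nil => exact ⟨f₀, by simp [Set.InjOn], by simp [Set.MapsTo], by simp, by simp⟩
  | @cons K K' A B hK h ih =>
    obtain ⟨hA₁, hA₂⟩ := List.pairwise_cons.1 hA
    obtain ⟨hB₁, hB₂⟩ := List.pairwise_cons.1 hB
    obtain ⟨f, hf⟩ := ih hA₂ hB₂
    obtain ⟨g, hg⟩ := hK
    have sepA : ∀ x ∈ K, ∀ y, (∃ M ∈ A, y ∈ M) → x ≠ y ∧ P.rel x y = ⊥ :=
      fun x hx y ⟨M, hM, hy⟩ => hA₁ M hM x hx y hy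
    have sepB : ∀ x ∈ K', ∀ y, (∃ M ∈ B, y ∈ M) → x ≠ y ∧ Q.rel x y = ⊥ :=
      fun x hx y ⟨M, hM, hy⟩ => hB₁ M hM x hx y hy
    classical
    let F : P.X → Q.X := fun x => if x ∈ K then g x else f x
    have Fg : ∀ x ∈ K, F x = g x := fun x hx => if_pos hx
    have Ff : ∀ x, (∃ M ∈ A, x ∈ M) → F x = f x :=
      fun x hx => if_neg fun h => (sepA x h x hx).1 rfl
    have split : ∀ x, (∃ M ∈ K :: A, x ∈ M) → x ∈ K ∨ ∃ M ∈ A, x ∈ M := by simp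
    refine ⟨F, ?_, ?_, ?_, ?_⟩
    · intro x hx y hy hxy
      rcases split x hx with hx | hx <;> rcases split y hy with hy | hy
      · rw [Fg x hx, Fg y hy] at hxy
        exact hg.injOn hx hy hxy
      · rw [Fg x hx, Ff y hy] at hxy
        exact absurd hxy (sepB _ (hg.mapsTo hx) _ (hf.mapsTo hy)).1
      · rw [Ff x hx, Fg y hy] at hxy
        exact absurd hxy.symm (sepB _ (hg.mapsTo hy) _ (hf.mapsTo hx)).1
      · rw [Ff x hx, Ff y hy] at hxy
        exact hf.injOn hx hy hxy
    · intro x hx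
      rcases split x hx with hx | hx
      · rw [Fg x hx]
        exact ⟨K', by simp, hg.mapsTo hx⟩
      · rw [Ff x hx]
        obtain ⟨M, hM, hx'⟩ := hf.mapsTo hx
        exact ⟨M, List.mem_cons_of_mem _ hM, hx'⟩
    · intro x hx
      rcases split x hx with hx | hx
      · rw [Fg x hx]
        exact hg.lab_eq x hx
      · rw [Ff x hx]
        exact hf.lab_eq x hx
    · intro x hx y hy
      rcases split x hx with hx | hx <;> rcases split y hy with hy | hy
      · rw [Fg x hx, Fg y hy]
        exact hg.rel_eq x hx y hy
      · rw [Fg x hx, Ff y hy, (sepA x hx y hy).2]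
        exact (sepB _ (hg.mapsTo hx) _ (hf.mapsTo hy)).2
      · rw [Ff x hx, Fg y hy, P.symm, (sepA y hy x hx).2]
        exact (Q.symm _ _).trans (sepB _ (hg.mapsTo hy) _ (hf.mapsTo hx)).2
      · rw [Ff x hx, Ff y hy]
        exact hf.rel_eq x hx y hy
  | @cons_right K' A B h ih =>
    obtain ⟨f, hf⟩ := ih hA (List.pairwise_cons.1 hB).2
    refine ⟨f, hf.injOn, fun x hx => ?_, hf.lab_eq, hf.rel_eq⟩
    obtain ⟨M, hM, hx'⟩ := hf.mapsTo hx
    exact ⟨M, List.mem_cons_of_mem _ hM, hx'⟩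

theorem sublistForall₂_map {α β γ δ : Type*} {R : γ → δ → Prop} {f : α → γ} {g : β → δ}
    {A : List α} {B : List β} (h : List.SublistForall₂ R (A.map f) (B.map g)) :
    List.SublistForall₂ (fun a b => R (f a) (g b)) A B := by
  obtain ⟨l, hl, hs⟩ := List.sublistForall₂_iff.1 h
  obtain ⟨B', hB', rfl⟩ := List.sublist_map_iff.1 hs
  exact List.sublistForall₂_iff.2
    ⟨B', List.forall₂_map_left_iff.1 (List.forall₂_map_right_iff.1 hl), hB'⟩

/-- By Higman's lemma, a well-quasi-order on connected pieces extends to arbitrary ones. -/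
theorem pwo_multiRooted {N : ℕ} (h : (rooted.{u, v} L D N).PartiallyWellOrderedOn Le) :
    (multiRooted.{u, v} L D N).PartiallyWellOrderedOn Le := by
  rw [Set.partiallyWellOrderedOn_iff_exists_lt]
  intro P hP
  have hfin : (Set.univ : Set Prop).PartiallyWellOrderedOn (· = ·) :=
    Set.finite_univ.partiallyWellOrderedOn
  -- There is no map from a nonempty carrier to an empty one, even if nothing has to be embedded;
  -- so whether the carrier is empty has to be recorded.
  obtain ⟨i, j, hij, hX, hs⟩ :=
    (hfin.prod (Set.PartiallyWellOrderedOn.partiallyWellOrderedOn_sublistForall₂ Le h)).exists_lt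
    (f := fun n => (Nonempty (P n).X, (P n).components.map (P n).restrict)) (by
      refine fun n => ⟨trivial, fun Q hQ => ?_⟩
      obtain ⟨K, hK, rfl⟩ := List.mem_map.1 hQ
      obtain ⟨x, hx, rfl⟩ := mem_components.1 hK
      obtain ⟨v, hv, hvx, hN⟩ := hP n x hx
      rw [← component_eq hv hvx]
      exact restrict_component_mem_rooted hv hN)
  have hX' : Nonempty (P i).X → Nonempty (P j).X := hX.mp
  obtain ⟨f, hf⟩ := exists_isEmbOn_of_sublistForall₂ (sublistForall₂_map hs)
    (pairwise_components _) (pairwise_components _) fun x => (hX' ⟨x⟩).some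
  simp only [exists_mem_components] at hf
  exact ⟨i, j, hij, f, hf⟩

/-- Each component of `P` without its root `v` contains a neighbour of `v`, and a path from that
neighbour can be prolonged by `v`. -/
theorem removeRoot_mem_multiRooted {P : Piece.{u, v} L D} {N : ℕ} {v : P.X} (hv : v ∈ P.S)
    (hr : ∀ x ∈ P.S, P.Reach v x) (hN : P.BoundedFrom (N + 1) v) :
    P.removeRoot v ∈ multiRooted (L × D) D N := by
  rintro x ⟨hxS, hxv⟩
  have key : x = v ∨ ∃ w, P.Adj v w ∧ w ∈ P.S \ {v} ∧ (P.removeRoot v).Reach w x := by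
    have hx := hr x hxS
    clear hxS hxv
    induction hx with
    | refl => exact .inl rfl
    | @tail b c _ hbc ih =>
      by_cases hc : c = v
      · exact .inl hc
      · right
        rcases ih with hb | ⟨w, hw, hwS, hwb⟩
        · exact ⟨c, hb ▸ hbc.1, ⟨hbc.2, hc⟩, .refl⟩
        · exact ⟨w, hw, hwS, .tail hwb ⟨hbc.1, hbc.2, hc⟩⟩
  obtain ⟨w, hw, hwS, hwx⟩ := key.resolve_left hxv
  refine ⟨w, hwS, hwx, fun l hl => ?_⟩
  have hp : P.IsPath (v :: w :: l) := by
    refine ⟨List.nodup_cons.2 ⟨fun h => (hl.mem v h).2 rfl, hl.nodup⟩,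
      List.isChain_cons_cons.2 ⟨hw, hl.chain⟩, fun y hy => ?_⟩
    rcases List.mem_cons.1 hy with rfl | hy
    · exact hv
    · exact (hl.mem y hy).1
  exact Nat.lt_of_succ_lt_succ (hN _ hp)

/-- Finitely many labels suffice for the root, and removing it shortens the paths. -/
theorem pwo_rooted (N : ℕ) (L : Type u) [Finite L] [Finite D] :
    (rooted.{u, v} L D N).PartiallyWellOrderedOn Le := by
  induction N generalizing L with
  | zero =>
    rw [Set.partiallyWellOrderedOn_iff_exists_lt]
    intro P hP
    obtain ⟨v, hv, -, hN⟩ := hP 0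
    exact absurd (hN [] ⟨by simp, by simp, by simpa using hv⟩) (by simp)
  | succ N ih =>
    rw [Set.partiallyWellOrderedOn_iff_exists_lt]
    intro P hP
    choose v hv hr hN using hP
    have hfin : (Set.univ : Set (L × D)).PartiallyWellOrderedOn (· = ·) :=
      Set.finite_univ.partiallyWellOrderedOn
    obtain ⟨i, j, hij, hroot, hle⟩ := (hfin.prod (pwo_multiRooted (ih (L × D)))).exists_lt
      (f := fun n => (((P n).lab (v n), (P n).rel (v n) (v n)), (P n).removeRoot (v n)))
      (fun n => ⟨trivial, removeRoot_mem_multiRooted (hv n) (hr n) (hN n)⟩)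
    obtain ⟨hlab, hrel⟩ := Prod.mk.inj hroot
    exact ⟨i, j, hij, hle.of_removeRoot (hv j) hlab hrel⟩

end Piece

/-! ### Incidence structures of hypergraphs -/

namespace Hypergraph

variable {Λ : Type u} {arity : Λ → ℕ}

/-- The incidence structure of `G`: its elements are the nodes (labelled `none`) and the edges of
`G`, and a node and an edge are related by the set of positions at which the node occurs in the
edge. The number `A` is meant to bound the arities, so that no position is missed. -/
def incidence (A : ℕ) (G : Hypergraph.{u, v} Λ arity) : Piece.{u, v} (Option Λ) (Set (Fin A)) where
  X := G.V ⊕ G.E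
  finite_X := haveI := G.finite_V; haveI := G.finite_E; inferInstance
  S := Set.univ
  lab := Sum.elim (fun _ => none) (fun e => some (G.lab e))
  rel
    | .inl x, .inr e => {i | (G.conn e)[(i : ℕ)]? = some x}
    | .inr e, .inl x => {i | (G.conn e)[(i : ℕ)]? = some x}
    | _, _ => ⊥
  symm := by rintro (x | e) (y | d) <;> rfl

theorem Embeds.of_incidence_le {A : ℕ} (hA : ∀ l, arity l ≤ A) {G H : Hypergraph.{u, v} Λ arity}
    (h : Piece.Le (G.incidence A) (H.incidence A)) : Embeds G H := by
  obtain ⟨F, hF⟩ := h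
  have hV : ∀ x : G.V, ∃ y : H.V, F (Sum.inl x) = Sum.inl y := by
    intro x
    have := hF.lab_eq (Sum.inl x) trivial
    rcases h : F (Sum.inl x) with y | e
    · exact ⟨y, rfl⟩
    · rw [h] at this
      cases this
  have hE : ∀ e : G.E, ∃ d : H.E, F (Sum.inr e) = Sum.inr d := by
    intro e
    have := hF.lab_eq (Sum.inr e) trivial
    rcases h : F (Sum.inr e) with y | e
    · rw [h] at this
      cases this
    · exact ⟨e, rfl⟩
  choose f hf using hV
  choose g hg using hE
  have hlab : ∀ e, H.lab (g e) = G.lab e := by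
    intro e
    have := hF.lab_eq (Sum.inr e) trivial
    rw [hg] at this
    exact Option.some_inj.1 this
  refine ⟨f, g, fun x y hxy => ?_, fun x y hxy => ?_, hlab, fun e => ?_⟩
  · exact Sum.inl_injective (hF.injOn trivial trivial (by rw [hf, hf, hxy]))
  · exact Sum.inr_injective (hF.injOn trivial trivial (by rw [hg, hg, hxy]))
  · have hlen : (H.conn (g e)).length = (G.conn e).length := by
      rw [H.length_conn, G.length_conn, hlab]
    refine List.ext_getElem (by rw [hlen, List.length_map]) fun i hi hi' => ?_
    have hiG : i < (G.conn e).length := hlen ▸ hi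
    have hiA : i < A := hiG.trans_le (G.length_conn e ▸ hA _)
    have hrel := hF.rel_eq (Sum.inl (G.conn e)[i]) trivial (Sum.inr e) trivial
    rw [hf, hg] at hrel
    have hmem : (⟨i, hiA⟩ : Fin A) ∈
        (G.incidence A).rel (Sum.inl (G.conn e)[i]) (Sum.inr e) :=
      List.getElem?_eq_getElem hiG
    rw [← hrel] at hmem
    have hmem' : (H.conn (g e))[i]? = some (f (G.conn e)[i]) := hmem
    rw [List.getElem?_eq_getElem hi] at hmem'
    rw [List.getElem_map]
    exact Option.some_inj.1 hmem'

theorem incidence_adj {A : ℕ} {G : Hypergraph.{u, v} Λ arity} {p q : G.V ⊕ G.E}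
    (h : (G.incidence A).Adj p q) :
    (∃ x e, p = Sum.inl x ∧ q = Sum.inr e ∧ x ∈ G.conn e) ∨
      ∃ x e, p = Sum.inr e ∧ q = Sum.inl x ∧ x ∈ G.conn e := by
  rcases p with x | e <;> rcases q with y | d
  · exact absurd rfl h
  · obtain ⟨i, hi⟩ := Set.nonempty_iff_ne_empty.2 h
    exact .inl ⟨x, d, rfl, rfl, List.mem_of_getElem? hi⟩
  · obtain ⟨i, hi⟩ := Set.nonempty_iff_ne_empty.2 h
    exact .inr ⟨y, e, rfl, rfl, List.mem_of_getElem? hi⟩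
  · exact absurd rfl h

/-- A path of the incidence structure that starts at a node alternates between nodes and edges. -/
theorem HasPath.of_incidence {A n : ℕ} {G : Hypergraph.{u, v} Λ arity} {p : List (G.V ⊕ G.E)}
    (hp : (G.incidence A).IsPath p) (hlen : 2 * n < p.length)
    (h0 : ∃ x, p[0] = Sum.inl x) : G.HasPath n := by
  have hadj : ∀ i (hi : i + 1 < p.length), (G.incidence A).Adj p[i] p[i + 1] :=
    fun i hi => List.isChain_iff_getElem.1 hp.chain i hi
  have hedge : ∀ i (hi : i + 1 < p.length), (∃ x, p[i] = Sum.inl x) →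
      ∃ e, p[i + 1] = Sum.inr e := by
    rintro i hi ⟨x, hx⟩
    rcases incidence_adj (hadj i hi) with ⟨y, e, h₁, h₂, -⟩ | ⟨y, e, h₁, h₂, -⟩
    · exact ⟨e, h₂⟩
    · rw [hx] at h₁
      cases h₁
  have hnode : ∀ i (hi : 2 * i < p.length), ∃ x, p[2 * i] = Sum.inl x := by
    intro i
    induction i with
    | zero => exact fun _ => h0
    | succ i ih =>
      intro hi
      obtain ⟨e, he⟩ := hedge (2 * i) (by omega) (ih (by omega))
      rcases incidence_adj (hadj (2 * i + 1) hi) with ⟨y, d, h₁, h₂, -⟩ | ⟨y, d, h₁, h₂, -⟩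
      · rw [he] at h₁
        cases h₁
      · exact ⟨y, h₂⟩
  choose x hx using fun i : Fin (n + 1) => hnode i (by omega)
  choose e he using fun i : Fin n => hedge (2 * i) (by omega) (hnode i (by omega))
  refine ⟨x, e, fun i j hij => ?_, fun i j hij => ?_, fun i => ⟨?_, ?_⟩⟩
  · have : p[2 * (i : ℕ)] = p[2 * (j : ℕ)] := by rw [hx, hx, hij]
    have := (hp.nodup.getElem_inj_iff).1 this
    exact Fin.ext (by omega)
  · have : p[2 * (i : ℕ) + 1] = p[2 * (j : ℕ) + 1] := by rw [he, he, hij]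
    have := (hp.nodup.getElem_inj_iff).1 this
    exact Fin.ext (by omega)
  · have h := hadj (2 * i) (by omega)
    have hxi : p[2 * (i : ℕ)] = Sum.inl (x i.castSucc) := hx i.castSucc
    rw [hxi, he] at h
    rcases incidence_adj h with ⟨y, d, h₁, h₂, h₃⟩ | ⟨y, d, h₁, h₂, h₃⟩
    · rwa [Sum.inl_injective h₁, Sum.inr_injective h₂]
    · cases h₁
  · have h := hadj (2 * i + 1) (by omega)
    have hxi : p[2 * (i : ℕ) + 1 + 1] = Sum.inl (x i.succ) := hx i.succ
    rw [hxi, he] at h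
    rcases incidence_adj h with ⟨y, d, h₁, h₂, h₃⟩ | ⟨y, d, h₁, h₂, h₃⟩
    · cases h₁
    · rwa [Sum.inr_injective h₁, Sum.inl_injective h₂]

/-- If all paths of `G` have length at most `k`, then a path of the incidence structure has at most
`2 * k + 3` elements: at most `k + 1` nodes, which alternate with edges, possibly with an edge at
either end. -/
theorem incidence_mem_multiRooted {A k : ℕ} {G : Hypergraph.{u, v} Λ arity}
    (h : G ∈ pathBounded.{u, v} arity k) :
    G.incidence A ∈ Piece.multiRooted (Option Λ) (Set (Fin A)) (2 * k + 3) := by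
  rw [mem_pathBounded_iff] at h
  refine fun x _ => ⟨x, trivial, .refl, fun l hl => ?_⟩
  by_contra! hlen
  apply h
  rcases x with x | e
  · exact HasPath.of_incidence hl (Nat.lt_succ_of_lt hlen) ⟨x, rfl⟩
  · -- A path that starts at an edge continues with a node.
    rcases l with _ | ⟨y, l⟩
    · simp at hlen
    · refine HasPath.of_incidence (p := y :: l) ⟨hl.nodup.of_cons, hl.chain.of_cons,
        fun _ _ => trivial⟩ hlen ?_
      rcases incidence_adj (List.isChain_cons_cons.1 hl.chain).1 with
        ⟨_, _, h₁, -, -⟩ | ⟨z, _, -, h₂, -⟩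
      · cases h₁
      · exact ⟨z, h₂⟩

/-- Hypergraphs with bounded paths are well-quasi-ordered by embedding; this is the version for
hypergraphs of Ding's theorem on graphs. -/
theorem pwo_pathBounded [Finite Λ] (k : ℕ) (G : ℕ → Hypergraph.{u, v} Λ arity)
    (hG : ∀ i, G i ∈ pathBounded.{u, v} arity k) : ∃ i j, i < j ∧ Embeds (G i) (G j) := by
  obtain ⟨A, hA⟩ : ∃ A, ∀ l, arity l ≤ A := by
    obtain ⟨A, hA⟩ := (Set.finite_range arity).bddAbove
    exact ⟨A, fun l => hA ⟨l, rfl⟩⟩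
  obtain ⟨i, j, hij, h⟩ := (Piece.pwo_multiRooted (Piece.pwo_rooted (2 * k + 3)
    (Option Λ))).exists_lt (f := fun i => (G i).incidence A)
    fun i => incidence_mem_multiRooted (hG i)
  exact ⟨i, j, hij, Embeds.of_incidence_le hA h⟩

end Hypergraph

/-! ### Deciding the bound on path lengths -/

/-- Primitive recursive predicates are closed under quantification over the lists of a fixed length
with bounded entries. -/
theorem primrecPred_exists_list {α : Type} [Primcodable α] {Q : α × List ℕ → Prop}
    (hQ : PrimrecPred Q) {b : α → ℕ} (hb : Primrec b) (m : ℕ) :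
    PrimrecPred fun a => ∃ l : List ℕ, l.length = m ∧ (∀ x ∈ l, x < b a) ∧ Q (a, l) := by
  induction m generalizing α with
  | zero =>
    refine (hQ.comp (Primrec.id.pair (.const []))).of_eq fun a => ?_
    constructor
    · exact fun h => ⟨[], rfl, by simp, h⟩
    · rintro ⟨l, hl, -, h⟩
      rwa [List.length_eq_zero_iff.1 hl] at h
  | succ m ih =>
    have h₁ : PrimrecPred fun p : (α × ℕ) × List ℕ => Q (p.1.1, p.1.2 :: p.2) :=
      hQ.comp ((Primrec.fst.comp .fst).pair
        (Primrec.list_cons.comp (Primrec.snd.comp .fst) .snd))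
    have h₂ := ih h₁ (b := fun p => b p.1) (hb.comp .fst)
    have h₃ : PrimrecRel fun (x : ℕ) (a : α) => ∃ l : List ℕ, l.length = m ∧
        (∀ y ∈ l, y < b a) ∧ Q (a, x :: l) := h₂.comp (Primrec.snd.pair .fst)
    refine (h₃.exists_mem_list.comp (Primrec.list_range.comp hb) .id).of_eq fun a => ?_
    constructor
    · rintro ⟨x, hx, l, hl, hb, h⟩
      refine ⟨x :: l, by simp [hl], fun y hy => ?_, h⟩
      rcases List.mem_cons.1 hy with rfl | hy
      · exact List.mem_range.1 hx
      · exact hb y hy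
    · rintro ⟨l, hl, hb, h⟩
      obtain ⟨x, l, rfl⟩ := List.exists_cons_of_length_eq_add_one hl
      exact ⟨x, List.mem_range.2 (hb x (by simp)), l, by simpa using hl,
        fun y hy => hb y (by simp [hy]), h⟩

theorem primrecPred_forall_lt {α : Type} [Primcodable α] {Q : ℕ → α → Prop} (hQ : PrimrecRel Q)
    (m : ℕ) : PrimrecPred fun a => ∀ i < m, Q i a :=
  (hQ.forall_mem_list.comp (.const (List.range m)) .id).of_eq fun a => by simp

theorem primrecRel_mem : PrimrecRel fun (x : ℕ) (l : List ℕ) => x ∈ l :=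
  ((PrimrecRel.exists_mem_list (R := fun x y : ℕ => x = y) Primrec.eq).comp .snd .fst).of_eq
    fun p => by simp

/-- The first `m` entries of `l` are pairwise distinct. -/
def DistinctEntries (m : ℕ) (l : List ℕ) : Prop :=
  ∀ i < m, ∀ j < m, ¬ (l.getD i 0 = l.getD j 0 ∧ i ≠ j)

theorem primrecPred_distinctEntries (m : ℕ) : PrimrecPred (DistinctEntries m) := by
  refine primrecPred_forall_lt (Q := fun i (l : List ℕ) =>
    ∀ j < m, ¬ (l.getD i 0 = l.getD j 0 ∧ i ≠ j)) ?_ m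
  refine primrecPred_forall_lt (α := ℕ × List ℕ) (Q := fun j p =>
    ¬ (p.2.getD p.1 0 = p.2.getD j 0 ∧ p.1 ≠ j)) ?_ m
  have hget : Primrec₂ fun (l : List ℕ) (i : ℕ) => l.getD i 0 := Primrec.list_getD 0
  have hl : Primrec fun p : ℕ × ℕ × List ℕ => p.2.2 := Primrec.snd.comp .snd
  have hi : Primrec fun p : ℕ × ℕ × List ℕ => p.2.1 := Primrec.fst.comp .snd
  exact .not (.and (Primrec.eq.comp (hget.comp hl hi) (hget.comp hl .fst))
    (.not (Primrec.eq.comp hi .fst)))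

/-- The nodes of the edge number `i` of a code. -/
def codeConn (c : ℕ × List (ℕ × List ℕ)) (i : ℕ) : List ℕ :=
  (c.2.getD i (0, [])).2

theorem primrec_codeConn : Primrec₂ codeConn :=
  Primrec.snd.comp ((Primrec.list_getD (0, [])).comp (Primrec.snd.comp .fst) .snd)

/-- The lists `p.1.2` of nodes and `p.2` of edges form a path of length `n` in the hypergraph
described by the code `p.1.1`. -/
def IsCodePath (n : ℕ) (p : ((ℕ × List (ℕ × List ℕ)) × List ℕ) × List ℕ) : Prop :=
  DistinctEntries (n + 1) p.1.2 ∧ DistinctEntries n p.2 ∧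
    ∀ i < n, p.1.2.getD i 0 ∈ codeConn p.1.1 (p.2.getD i 0) ∧
      p.1.2.getD (i + 1) 0 ∈ codeConn p.1.1 (p.2.getD i 0)

theorem primrecPred_isCodePath (n : ℕ) : PrimrecPred (IsCodePath n) := by
  have hget : Primrec₂ fun (l : List ℕ) (i : ℕ) => l.getD i 0 := Primrec.list_getD 0
  refine ((primrecPred_distinctEntries _).comp (Primrec.snd.comp .fst)).and
    (((primrecPred_distinctEntries _).comp .snd).and (primrecPred_forall_lt
      (Q := fun i (p : ((ℕ × List (ℕ × List ℕ)) × List ℕ) × List ℕ) =>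
        p.1.2.getD i 0 ∈ codeConn p.1.1 (p.2.getD i 0) ∧
          p.1.2.getD (i + 1) 0 ∈ codeConn p.1.1 (p.2.getD i 0)) ?_ n))
  have hc : Primrec fun q : ℕ × ((ℕ × List (ℕ × List ℕ)) × List ℕ) × List ℕ =>
      codeConn q.2.1.1 (q.2.2.getD q.1 0) :=
    primrec_codeConn.comp (Primrec.fst.comp (Primrec.fst.comp .snd))
      (hget.comp (Primrec.snd.comp .snd) .fst)
  have hx : Primrec fun q : ℕ × ((ℕ × List (ℕ × List ℕ)) × List ℕ) × List ℕ => q.2.1.2 :=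
    Primrec.snd.comp (Primrec.fst.comp .snd)
  exact .and (primrecRel_mem.comp (hget.comp hx .fst) hc)
    (primrecRel_mem.comp (hget.comp hx (Primrec.succ.comp .fst)) hc)

/-- The hypergraph described by the code `c` has a path of length `n`. -/
def CodeHasPath (n : ℕ) (c : ℕ × List (ℕ × List ℕ)) : Prop :=
  ∃ xs : List ℕ, xs.length = n + 1 ∧ (∀ x ∈ xs, x < c.1) ∧
    ∃ es : List ℕ, es.length = n ∧ (∀ e ∈ es, e < c.2.length) ∧ IsCodePath n ((c, xs), es)

theorem primrecPred_codeHasPath (n : ℕ) : PrimrecPred (CodeHasPath n) :=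
  primrecPred_exists_list
    (Q := fun q : (ℕ × List (ℕ × List ℕ)) × List ℕ => ∃ es : List ℕ, es.length = n ∧
      (∀ e ∈ es, e < q.1.2.length) ∧ IsCodePath n (q, es))
    (primrecPred_exists_list (primrecPred_isCodePath n)
      (b := fun q : (ℕ × List (ℕ × List ℕ)) × List ℕ => q.1.2.length)
      (Primrec.list_length.comp (Primrec.snd.comp .fst)) n) Primrec.fst (n + 1)

namespace Hypergraph

variable {Λ : Type u} {arity : Λ → ℕ}

theorem exists_isCode (num : Λ → ℕ) (G : Hypergraph.{u, v} Λ arity) :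
    ∃ c, IsCode num c G := by
  have := G.finite_V
  have := G.finite_E
  obtain ⟨n, ⟨f⟩⟩ := Finite.exists_equiv_fin G.V
  obtain ⟨m, ⟨g⟩⟩ := Finite.exists_equiv_fin G.E
  refine ⟨(n, List.ofFn fun i : Fin m =>
    (num (G.lab (g.symm i)), (G.conn (g.symm i)).map fun x => (f x : ℕ))), f,
    g.trans (finCongr (by simp)), fun e => ?_⟩
  simp

/-- Paths in the coded hypergraph and paths in the code correspond, whatever the numberings of
nodes and edges are. -/
theorem codeHasPath_iff {num : Λ → ℕ} {c : ℕ × List (ℕ × List ℕ)} {G : Hypergraph.{u, v} Λ arity}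
    (h : IsCode num c G) (n : ℕ) : CodeHasPath n c ↔ G.HasPath n := by
  obtain ⟨f, g, h⟩ := h
  have hconn : ∀ (x : G.V) (e : G.E), (f x : ℕ) ∈ codeConn c (g e) ↔ x ∈ G.conn e := by
    intro x e
    have : codeConn c (g e) = (G.conn e).map fun x => (f x : ℕ) := by
      rw [codeConn, List.getD_eq_getElem _ _ (g e).2]
      exact congrArg Prod.snd (h e)
    rw [this]
    exact List.mem_map_of_injective (Fin.val_injective.comp f.injective)
  constructor
  · rintro ⟨xs, hxs, hxb, es, hes, heb, hx, he, hp⟩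
    have hxb' : ∀ i : Fin (n + 1), xs.getD i 0 < c.1 := fun i => by
      rw [List.getD_eq_getElem _ _ (by omega)]
      exact hxb _ (List.getElem_mem _)
    have heb' : ∀ i : Fin n, es.getD i 0 < c.2.length := fun i => by
      rw [List.getD_eq_getElem _ _ (by omega)]
      exact heb _ (List.getElem_mem _)
    refine ⟨fun i => f.symm ⟨_, hxb' i⟩, fun i => g.symm ⟨_, heb' i⟩, fun i j hij => ?_,
      fun i j hij => ?_, fun i => ?_⟩
    · by_contra hne
      exact hx i i.2 j j.2 ⟨congrArg Fin.val (f.symm.injective hij), fun h => hne (Fin.ext h)⟩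
    · by_contra hne
      exact he i i.2 j j.2 ⟨congrArg Fin.val (g.symm.injective hij), fun h => hne (Fin.ext h)⟩
    · rw [← hconn, ← hconn]
      simpa using hp i i.2
  · rintro ⟨x, e, hx, he, hp⟩
    have hgx : ∀ i : Fin (n + 1),
        (List.ofFn fun i => (f (x i) : ℕ)).getD i 0 = f (x i) := fun i => by
      rw [List.getD_eq_getElem _ _ (by rw [List.length_ofFn]; exact i.2), List.getElem_ofFn]
    have hge : ∀ i : Fin n, (List.ofFn fun i => (g (e i) : ℕ)).getD i 0 = g (e i) :=
      fun i => by rw [List.getD_eq_getElem _ _ (by simp), List.getElem_ofFn]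
    refine ⟨List.ofFn fun i => (f (x i) : ℕ), by simp, by simp [List.mem_ofFn],
      List.ofFn fun i => (g (e i) : ℕ), by simp, by simp [List.mem_ofFn], ?_, ?_, ?_⟩
    · rintro i hi j hj ⟨hij, hne⟩
      have := (hgx ⟨i, hi⟩).symm.trans (hij.trans (hgx ⟨j, hj⟩))
      exact hne (congrArg Fin.val (hx (f.injective (Fin.ext this))))
    · rintro i hi j hj ⟨hij, hne⟩
      have := (hge ⟨i, hi⟩).symm.trans (hij.trans (hge ⟨j, hj⟩))
      exact hne (congrArg Fin.val (he (g.injective (Fin.ext this))))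
    · intro i hi
      have h₁ := hgx (Fin.castSucc ⟨i, hi⟩)
      have h₂ := hgx (Fin.succ ⟨i, hi⟩)
      have h₃ := hge ⟨i, hi⟩
      dsimp only [Fin.val_castSucc, Fin.val_succ] at h₁ h₂ h₃ ⊢
      rw [h₁, h₂, h₃, hconn, hconn]
      exact hp ⟨i, hi⟩

end Hypergraph

end GTS

theorem mainTheorem3 {Λ : Type u} [Finite Λ] (arity : Λ → ℕ)
    (num : Λ → ℕ) (hnum : Function.Injective num)
    (𝓡 : Set (GTS.Rule.{u, v} Λ arity)) (h𝓡 : 𝓡.Finite) (k : ℕ) :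
    GTS.IsRestrictedWSTS (GTS.Hypergraph.IsCode num)
      (GTS.Hypergraph.pathBounded.{u, v} arity k)
      (GTS.Step 𝓡) GTS.Hypergraph.IsSubgraph where
  exists_code := GTS.Hypergraph.exists_isCode num
  decidable_mem := ⟨fun c => ¬ GTS.CodeHasPath (k + 1) c,
    (GTS.primrecPred_codeHasPath (k + 1)).not.computablePred, fun c G h =>
      (not_congr (GTS.Hypergraph.codeHasPath_iff h _)).trans
        GTS.Hypergraph.mem_pathBounded_iff.symm⟩
  downward_closed G H h hH n hn := hH n (hn.of_embeds h.embeds)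
  refl G := (GTS.Hypergraph.Embeds.refl G).isSubgraph
  trans G H K h h' := (h.embeds.trans h'.embeds).isSubgraph
  wqo G hG := by
    obtain ⟨i, j, hij, h⟩ := GTS.Hypergraph.pwo_pathBounded k G hG
    exact ⟨i, j, hij, h.isSubgraph⟩
  compat := by
    rintro G H K h ⟨r, hr, hGH⟩
    obtain ⟨M, hKM, hHM⟩ := hGH.of_embeds h.embeds
    exact ⟨M, .single ⟨r, hr, hKM⟩, hHM.isSubgraph⟩
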